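/- Let $n,p$ be integers with $1\le p\le n$ and let $d\in(0,1)$. Let $T$ be any nondegenerate closed triangle in the Euclidean plane with a selected side of length $n+d$. A \emph{homothetic unit triangle} is an image of $T$ under a homothety (of positive or negative ratio) or a translation whose side corresponding to the selected side has length $1$. (1) $T$ can be covered by $n^2+2p$ homothetic unit triangles if and only if $d\le \frac{p}{n+1}$. (2) If $d\le\frac{p}{n+1}$, then the following explicit family \textsc{CoverTriangle} (Full Even) consists of homothetic unit triangles and covers $T$. It has exactly $n^2+2q$ members, where $q\le p$ and $q$ is the least integer $q'\ge 1$ such that $T$ can be covered by $n^2+2q'$ homothetic unit triangles. \textsc{CoverTriangle} (Full Even): let $j=\lfloor(1-d)(n+1)\rfloor$. Use coordinates $(a,b)$ in which the vertex opposite the selected side is $(0,0)$ and $T=\{0\le b\le a\le n+d\}$, the selected side being $a=n+d$. An up-triangle with acme $(a,b)$ has the other vertices $(a+1,b),(a+1,b+1)$; a down-triangle with nadir $(a,b)$ has the other vertices $(a-1,b),(a-1,b-1)$. If $j\ge1$, put $s_k=0$ for $k<j$, $s_k=\frac{j}{k(k+1)}$ for $k\ge j$, $D_k=k+\sum_{i=1}^{k}s_i$,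 and $m_k=k$ for $k<j$, $m_k=k+1$ for $k\ge j$. For each $k=1,\dots,n$, row $k$ consists of the up-triangles with acme $(D_k-1,\ i(1-s_k))$, $0\le i<m_k$, and the down-triangles with nadir $(D_k-s_k,\ (i+1)(1-s_k))$, $0\le i<m_k-1$. If $j=0$ (which does not occur when $d\le\frac{p}{n+1}$), the standard covering of a triangle with selected side $n+1$ by $(n+1)^2$ unit triangles is used. -/

import Mathlib

namespace TriangleCovering

/-- The Euclidean plane. -/
abbrev Plane : Type := EuclideanSpace ℝ (Fin 2)

/-- A nondegenerate triangle with labelled vertices `0, 1, 2`.  The selected side is the one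
joining vertices `0` and `1`; vertex `2` is the acme.  Since the labelling is arbitrary, every side
of every triangle can be the selected one. -/
abbrev Tri : Type := Affine.Triangle ℝ Plane

/-- The length of the selected side. -/
noncomputable def sideLength (T : Tri) : ℝ := dist (T.points 0) (T.points 1)

/-- The closed triangular region. -/
def region (T : Tri) : Set Plane := convexHull ℝ (Set.range T.points)

/-- `S` is homothetic to `T`: it is the image of `T` under a homothety or a translation
(the ratio `k` may be negative, which turns `T` upside down). -/
def Homothetic (S T : Tri) : Prop :=
  ∃ k : ℝ, k ≠ 0 ∧ ∃ v : Plane, ∀ i, S.points i = k • T.points i + v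

/-- `S` is a unit triangle homothetic to `T`: the side of `S` that corresponds to the selected side
of `T` has length `1`. -/
def IsHomotheticUnit (S T : Tri) : Prop :=
  Homothetic S T ∧ sideLength S = 1

/-- `F` is a list of unit triangles homothetic to `T` that together cover `T`. -/
def IsUnitCovering (F : List Tri) (T : Tri) : Prop :=
  (∀ S ∈ F, IsHomotheticUnit S T) ∧ region T ⊆ ⋃ S ∈ F, region S

/-- `T` can be covered by `N` unit triangles homothetic to it. -/
def CoverableBy (T : Tri) (N : ℕ) : Prop :=
  ∃ F : List Tri, F.length = N ∧ IsUnitCovering F T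

theorem sideLength_ne_zero (T : Tri) : sideLength T ≠ 0 :=
  dist_ne_zero.mpr (T.independent.injective.ne (by decide))

theorem unit_copy_independent (T : Tri) (ε : ℤˣ) (P : Plane) :
    AffineIndependent ℝ
      (fun i => (((ε : ℤ) : ℝ) / sideLength T) • (T.points i - T.points 2) + P) := by
  have hc : (((ε : ℤ) : ℝ) / sideLength T) ≠ 0 :=
    div_ne_zero (by exact_mod_cast ε.ne_zero) (sideLength_ne_zero T)
  set c := ((ε : ℤ) : ℝ) / sideLength T
  let f : Plane →ᵃ[ℝ] Plane :=
    (c • (AffineMap.id ℝ Plane - AffineMap.const ℝ Plane (T.points 2))) + AffineMap.const ℝ Plane P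
  have hf : Function.Injective f := by
    intro x y h
    have h' : c • (x - T.points 2) + P = c • (y - T.points 2) + P := h
    have h2 := smul_right_injective Plane hc (add_right_cancel h')
    exact sub_left_inj.mp h2
  exact T.independent.map' f hf

/-- The unit copy of `T` (`ε = 1`: same orientation, `ε = -1`: upside down) whose vertex `2` is
at the point `P`. -/
noncomputable def unitCopy (T : Tri) (ε : ℤˣ) (P : Plane) : Tri where
  points i := (((ε : ℤ) : ℝ) / sideLength T) • (T.points i - T.points 2) + P
  independent := unit_copy_independent T ε P

/-- The point with coordinates `(a, b)`: start at the acme of `T`, go down the left leg by `a`, then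
to the right, parallel to the selected side, by `b`.  Lengths are measured in multiples of the
corresponding sides of a unit triangle, so that `T` is `0 ≤ b ≤ a ≤ sideLength T`. -/
noncomputable def pt (T : Tri) (a b : ℝ) : Plane :=
  T.points 2 + (a / sideLength T) • (T.points 0 - T.points 2)
    + (b / sideLength T) • (T.points 1 - T.points 0)

/-- The unit up-triangle with acme at `(a, b)`: its other vertices are `(a + 1, b)` and
`(a + 1, b + 1)`. -/
noncomputable def upTri (T : Tri) (a b : ℝ) : Tri := unitCopy T 1 (pt T a b)

/-- The unit down-triangle with nadir at `(a, b)`: its other vertices are `(a - 1, b)` and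
`(a - 1, b - 1)`. -/
noncomputable def downTri (T : Tri) (a b : ℝ) : Tri := unitCopy T (-1) (pt T a b)

/-- A row of `m` up-triangles with bases at depth `D`, and `m - 1` down-triangles between them,
after an up-left slide operation with slide value `s`: each down-triangle has been moved up and left
by `s` along the right leg of the up-triangle before it, and each up-triangle touches the right
leg of the down-triangle before it. -/
noncomputable def row (T : Tri) (m : ℕ) (D s : ℝ) : List Tri :=
  ((List.range m).map fun i => upTri T (D - 1) ((i : ℝ) * (1 - s))) ++
    ((List.range (m - 1)).map fun i => downTri T (D - s) (((i : ℝ) + 1) * (1 - s)))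

/-- The covering of a triangle with selected side `m` (with the acme of `T`) by `m ^ 2` unit
triangles: row `k` has `k` up-triangles and `k - 1` down-triangles, without sliding. -/
noncomputable def naiveCover (T : Tri) (m : ℕ) : List Tri :=
  (List.range m).flatMap fun i => row T (i + 1) ((i : ℝ) + 1) 0

/-- The slide value of row `k` when the extra pairs start on row `j`. -/
noncomputable def slide (j k : ℕ) : ℝ :=
  if k < j then 0 else (j : ℝ) / ((k : ℝ) * ((k : ℝ) + 1))

/-- The depth of the base of row `k`. -/
noncomputable def depth (j k : ℕ) : ℝ := (k : ℝ) + ∑ i ∈ Finset.Icc 1 k, slide j i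

/-- The number of up-triangles in row `k`: rows `j, j + 1, …` receive an extra pair. -/
def rowSize (j k : ℕ) : ℕ := if k < j then k else k + 1

/-- CoverTriangle (Basic Even): the rows `1, …, n`, with extra pairs and slides from row `j` on. -/
noncomputable def basicEven (T : Tri) (n j : ℕ) : List Tri :=
  (List.range n).flatMap fun i => row T (rowSize j (i + 1)) (depth j (i + 1)) (slide j (i + 1))

/-- The row selected by CoverTriangle (Full Even). -/
noncomputable def selectedRow (n : ℕ) (d : ℝ) : ℕ := ⌊(1 - d) * ((n : ℝ) + 1)⌋₊

/-- CoverTriangle (Full Even), for a triangle with selected side `n + d`: Basic Even with the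
selected row, or the naive covering of a triangle with selected side `n + 1` if that row is `0`. -/
noncomputable def fullEven (T : Tri) (n : ℕ) (d : ℝ) : List Tri :=
  if selectedRow n d = 0 then naiveCover T (n + 1) else basicEven T n (selectedRow n d)

end TriangleCovering

namespace TriangleCovering

open MeasureTheory Set

/-! Lower bound. The slice of `T` at depth `x` has length `x`, so the slices of the covering
triangles there have total length at least `x`. Summing over depths `t, t + 1, …`, a unit triangle
contributes at most one slice, of length `Int.fract (ε * (t - a))` for almost every `t`. The sum `G`
of these fractional parts has integral `N / 2` over `[0, 1]`, where `N` is the number of triangles.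
Integrating the slice bounds directly is too weak; the gain comes from integrality. Modulo 1, `G t -
(n + 1) * t` equals `c + K * t` with an integer `K`, and `N ≡ n (mod 2)` makes `K` odd, hence
nonzero. So `G` is `(n + 1) * t`, plus an integer, plus a fractional part of mean `1 / 2`. The slice
bounds force that integer up, separately for `t < d` and `t > d`, and integration yields `n ^ 2 + 2
* (n + 1) * d ≤ N` (`card_ge_of_slices`).

Upper bound. The slides telescope to `depth j n = n + 1 - j / (n + 1)`, which reaches `n + d`
exactly when `j ≤ (1 - d) * (n + 1)`. The floor is the largest such `j`, hence the cheapest covering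
of the family, and its size meets the lower bound. -/

/-! ### Oblique coordinates and membership in regions. -/

theorem linearIndependent_legs (T : Tri) :
    LinearIndependent ℝ ![T.points 0 - T.points 2, T.points 1 - T.points 0] := by
  rw [LinearIndependent.pair_iff]
  intro x y h
  have h1 := (affineIndependent_iff.mp T.independent) Finset.univ ![x - y, y, -x]
    (by simp [Fin.sum_univ_three])
    (by
      rw [← h, Fin.sum_univ_three]
      change (x - y) • T.points 0 + y • T.points 1 + (-x) • T.points 2 = _
      module)
  have hy := h1 1 (Finset.mem_univ _)
  have hx := h1 2 (Finset.mem_univ _)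
  simp at hx hy
  exact ⟨hx, hy⟩

theorem pt_injective {T : Tri} {a b a' b' : ℝ} (h : pt T a b = pt T a' b') :
    a = a' ∧ b = b' := by
  have hs := sideLength_ne_zero T
  have h1 := LinearIndependent.pair_iff.mp (linearIndependent_legs T)
    (a / sideLength T - a' / sideLength T) (b / sideLength T - b' / sideLength T) (by
      have h2 := sub_eq_zero.mpr h
      rw [← h2, pt, pt]
      module)
  obtain ⟨h2, h3⟩ := h1
  rw [← sub_div, div_eq_zero_iff] at h2 h3
  exact ⟨by have := h2.resolve_right hs; linarith, by have := h3.resolve_right hs; linarith⟩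

theorem exists_eq_pt (T : Tri) (P : Plane) : ∃ a b, P = pt T a b := by
  have hs := sideLength_ne_zero T
  have h := (linearIndependent_legs T).span_eq_top_of_card_eq_finrank (by simp)
  have h1 : P - T.points 2 ∈ Submodule.span ℝ
      (Set.range ![T.points 0 - T.points 2, T.points 1 - T.points 0]) := by
    rw [h]; trivial
  rw [Matrix.range_cons_cons_empty, Submodule.mem_span_pair] at h1
  obtain ⟨x, y, hxy⟩ := h1
  refine ⟨x * sideLength T, y * sideLength T, ?_⟩
  rw [pt, mul_div_cancel_right₀ _ hs, mul_div_cancel_right₀ _ hs, add_assoc, hxy]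
  abel

theorem mem_region_iff (S : Tri) (x : Plane) :
    x ∈ region S ↔ ∃ u v : ℝ, 0 ≤ v ∧ v ≤ u ∧ u ≤ 1 ∧
      x = S.points 2 + u • (S.points 0 - S.points 2) + v • (S.points 1 - S.points 0) := by
  constructor
  · suffices h : region S ⊆ {x | ∃ u v : ℝ, 0 ≤ v ∧ v ≤ u ∧ u ≤ 1 ∧
        x = S.points 2 + u • (S.points 0 - S.points 2) + v • (S.points 1 - S.points 0)} from
      fun hx => h hx
    refine convexHull_min ?_ ?_
    · rintro _ ⟨i, rfl⟩
      fin_cases i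
      · exact ⟨1, 0, by simp⟩
      · exact ⟨1, 1, by simp⟩
      · exact ⟨0, 0, by simp⟩
    · rintro _ ⟨u, v, h0, h1, h2, rfl⟩ _ ⟨u', v', h0', h1', h2', rfl⟩ α β hα hβ hαβ
      refine ⟨α * u + β * u', α * v + β * v', by positivity, by gcongr, ?_, ?_⟩
      · calc α * u + β * u' ≤ α * 1 + β * 1 := by gcongr
          _ = 1 := by rw [mul_one, mul_one, hαβ]
      · obtain rfl : β = 1 - α := by linarith
        module
  · rintro ⟨u, v, h0, h1, h2, rfl⟩
    refine mem_convexHull_of_exists_fintype ![u - v, v, 1 - u] S.points ?_ ?_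
      (fun i => mem_range_self i) ?_
    · intro i
      fin_cases i <;> simp <;> linarith
    · simp [Fin.sum_univ_three]
    · rw [Fin.sum_univ_three]
      change (u - v) • S.points 0 + v • S.points 1 + (1 - u) • S.points 2 = _
      module

theorem homothetic_points {S T : Tri} {c a₀ b₀ : ℝ}
    (hS : ∀ i, S.points i = c • (T.points i - T.points 2) + pt T a₀ b₀) (u v : ℝ) :
    S.points 2 + u • (S.points 0 - S.points 2) + v • (S.points 1 - S.points 0) =
      pt T (a₀ + u * (c * sideLength T)) (b₀ + v * (c * sideLength T)) := by
  have hs := sideLength_ne_zero T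
  have h1 : (a₀ + u * (c * sideLength T)) / sideLength T = a₀ / sideLength T + u * c := by
    field_simp
  have h2 : (b₀ + v * (c * sideLength T)) / sideLength T = b₀ / sideLength T + v * c := by
    field_simp
  rw [hS 0, hS 1, hS 2, pt, pt, h1, h2]
  module

theorem pt_mem_unitCopy_iff (T : Tri) (ε : ℤˣ) (a₀ b₀ a b : ℝ) :
    pt T a b ∈ region (unitCopy T ε (pt T a₀ b₀)) ↔
      0 ≤ ((ε : ℤ) : ℝ) * (b - b₀) ∧ ((ε : ℤ) : ℝ) * (b - b₀) ≤ ((ε : ℤ) : ℝ) * (a - a₀) ∧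
        ((ε : ℤ) : ℝ) * (a - a₀) ≤ 1 := by
  have hε : ((ε : ℤ) : ℝ) * ((ε : ℤ) : ℝ) = 1 := by
    rcases Int.units_eq_one_or ε with h | h <;> simp [h]
  have key := fun u v => homothetic_points (S := unitCopy T ε (pt T a₀ b₀)) (T := T)
    (c := ((ε : ℤ) : ℝ) / sideLength T) (a₀ := a₀) (b₀ := b₀) (fun _ => rfl) u v
  simp only [div_mul_cancel₀ _ (sideLength_ne_zero T)] at key
  rw [mem_region_iff]
  constructor
  · rintro ⟨u, v, h0, h1, h2, h⟩
    rw [key] at h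
    obtain ⟨rfl, rfl⟩ := pt_injective h
    have e1 : ∀ x y : ℝ, ((ε : ℤ) : ℝ) * (x + y * ((ε : ℤ) : ℝ) - x) = y := fun x y => by
      linear_combination y * hε
    rw [e1, e1]
    exact ⟨h0, h1, h2⟩
  · rintro ⟨h0, h1, h2⟩
    refine ⟨_, _, h0, h1, h2, ?_⟩
    rw [key]
    congr 1
    · linear_combination (a₀ - a) * hε
    · linear_combination (b₀ - b) * hε

theorem mem_region_self_iff (T : Tri) (x : Plane) :
    x ∈ region T ↔ ∃ a b, 0 ≤ b ∧ b ≤ a ∧ a ≤ sideLength T ∧ x = pt T a b := by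
  have hs : 0 < sideLength T := lt_of_le_of_ne dist_nonneg (sideLength_ne_zero T).symm
  rw [mem_region_iff]
  constructor
  · rintro ⟨u, v, h0, h1, h2, rfl⟩
    refine ⟨u * sideLength T, v * sideLength T, by positivity, by gcongr, by nlinarith, ?_⟩
    rw [pt, mul_div_cancel_right₀ _ hs.ne', mul_div_cancel_right₀ _ hs.ne']
  · rintro ⟨a, b, h0, h1, h2, rfl⟩
    exact ⟨a / sideLength T, b / sideLength T, by positivity, by gcongr,
      (div_le_one hs).mpr h2, rfl⟩

theorem isHomotheticUnit_unitCopy (T : Tri) (ε : ℤˣ) (P : Plane) :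
    IsHomotheticUnit (unitCopy T ε P) T := by
  have hs := sideLength_ne_zero T
  refine ⟨⟨((ε : ℤ) : ℝ) / sideLength T, div_ne_zero (by exact_mod_cast ε.ne_zero) hs,
    P - (((ε : ℤ) : ℝ) / sideLength T) • T.points 2, fun i => ?_⟩, ?_⟩
  · simp only [unitCopy]
    module
  · have : sideLength (unitCopy T ε P) = |((ε : ℤ) : ℝ) / sideLength T| * sideLength T := by
      simp only [sideLength, unitCopy, dist_add_right, dist_smul₀, dist_sub_right, Real.norm_eq_abs]
    rw [this, abs_div, abs_of_nonneg (a := sideLength T) dist_nonneg, div_mul_cancel₀ _ hs]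
    rcases Int.units_eq_one_or ε with h | h <;> simp [h]

theorem IsHomotheticUnit.exists_eq_unitCopy {S T : Tri} (h : IsHomotheticUnit S T) :
    ∃ (ε : ℤˣ) (a b : ℝ), S = unitCopy T ε (pt T a b) := by
  obtain ⟨⟨k, hk, v, hS⟩, h1⟩ := h
  have hs := sideLength_ne_zero T
  have h2 : |k| * sideLength T = 1 := by
    rw [← h1]
    simp only [sideLength, hS, dist_add_right, dist_smul₀, Real.norm_eq_abs]
  obtain ⟨ε, hε⟩ : ∃ ε : ℤˣ, ((ε : ℤ) : ℝ) / sideLength T = k := by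
    rcases abs_choice k with h | h
    · exact ⟨1, by rw [h] at h2; rw [div_eq_iff hs, h2]; simp⟩
    · exact ⟨-1, by rw [h] at h2; rw [div_eq_iff hs]; push_cast; linarith⟩
  obtain ⟨a, b, hab⟩ := exists_eq_pt T (k • T.points 2 + v)
  refine ⟨ε, a, b, ?_⟩
  ext1 i
  simp only [unitCopy, ← hab, hε, hS]
  module

/-! ### Lower bound: slices and fractional parts. -/

/-- The length of the slice of a unit triangle at distance `x` from its acme (or nadir). -/
noncomputable def sliceLength (x : ℝ) : ℝ := if 0 ≤ x ∧ x ≤ 1 then x else 0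

theorem volume_slice_le (ε : ℤˣ) (b₀ x : ℝ) :
    volume {b : ℝ | 0 ≤ ((ε : ℤ) : ℝ) * (b - b₀) ∧ ((ε : ℤ) : ℝ) * (b - b₀) ≤ x ∧ x ≤ 1} ≤
      ENNReal.ofReal (sliceLength x) := by
  by_cases hx : 0 ≤ x ∧ x ≤ 1
  · rw [sliceLength, if_pos hx]
    rcases Int.units_eq_one_or ε with rfl | rfl
    · calc _ ≤ volume (Icc b₀ (b₀ + x)) := measure_mono fun b hb => by
            simp at hb
            constructor <;> linarith [hb.1, hb.2.1]
        _ = _ := by simp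
    · calc _ ≤ volume (Icc (b₀ - x) b₀) := measure_mono fun b hb => by
            simp at hb
            constructor <;> linarith [hb.1, hb.2.1]
        _ = _ := by simp
  · have : {b : ℝ | 0 ≤ ((ε : ℤ) : ℝ) * (b - b₀) ∧ ((ε : ℤ) : ℝ) * (b - b₀) ≤ x ∧ x ≤ 1} = ∅ := by
      ext b
      simp only [mem_ofPred_eq, mem_empty_iff_false, iff_false]
      exact fun h => hx ⟨h.1.trans h.2.1, h.2.2⟩
    rw [this]
    simp

theorem sliceLength_nonneg (x : ℝ) : 0 ≤ sliceLength x := by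
  rw [sliceLength]
  split_ifs with h
  exacts [h.1, le_rfl]

theorem le_sum_sliceLength {ι : Type*} [Fintype ι] (T : Tri) (ε : ι → ℤˣ) (a b : ι → ℝ)
    (h : region T ⊆ ⋃ i, region (unitCopy T (ε i) (pt T (a i) (b i)))) {x : ℝ}
    (hx : x ≤ sideLength T) :
    x ≤ ∑ i, sliceLength (((ε i : ℤ) : ℝ) * (x - a i)) := by
  have h1 : Icc 0 x ⊆ ⋃ i, {y : ℝ | 0 ≤ ((ε i : ℤ) : ℝ) * (y - b i) ∧
      ((ε i : ℤ) : ℝ) * (y - b i) ≤ ((ε i : ℤ) : ℝ) * (x - a i) ∧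
      ((ε i : ℤ) : ℝ) * (x - a i) ≤ 1} := by
    intro y hy
    obtain ⟨i, hi⟩ := mem_iUnion.mp
      (h ((mem_region_self_iff T (pt T x y)).mpr ⟨x, y, hy.1, hy.2, hx, rfl⟩))
    exact mem_iUnion.mpr ⟨i, (pt_mem_unitCopy_iff ..).mp hi⟩
  have h2 := calc ENNReal.ofReal x = volume (Icc 0 x) := by simp
    _ ≤ _ := measure_mono h1
    _ ≤ _ := measure_iUnion_fintype_le _ _
    _ ≤ ∑ i, ENNReal.ofReal (sliceLength (((ε i : ℤ) : ℝ) * (x - a i))) :=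
      Finset.sum_le_sum fun i _ => volume_slice_le _ _ _
  rw [← ENNReal.ofReal_sum_of_nonneg fun i _ => sliceLength_nonneg _] at h2
  exact (ENNReal.ofReal_le_ofReal_iff (Finset.sum_nonneg fun i _ => sliceLength_nonneg _)).mp h2

/-- The arguments are spaced by 1, so at most one lies in `[0, 1]`, and it equals the fractional
part. Integral `x` must be excluded: a full base has slice length 1 but fractional part 0. -/
theorem sum_sliceLength_le_fract (ε : ℤˣ) {x : ℝ} (hx : Int.fract x ≠ 0) (m : ℕ) :
    ∑ k ∈ Finset.range m, sliceLength (x + ((ε : ℤ) : ℝ) * k) ≤ Int.fract x := by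
  have hfr : ∀ k : ℕ, Int.fract (x + ((ε : ℤ) : ℝ) * k) = Int.fract x := fun k => by
    have : x + ((ε : ℤ) : ℝ) * k = x + (((ε : ℤ) * k : ℤ) : ℝ) := by push_cast; ring
    rw [this, Int.fract_add_intCast]
  have hval : ∀ k : ℕ, sliceLength (x + ((ε : ℤ) : ℝ) * k) ≠ 0 →
      x + ((ε : ℤ) : ℝ) * k = Int.fract x := fun k hk => by
    rw [sliceLength] at hk
    split_ifs at hk with h
    · have h1 : x + ((ε : ℤ) : ℝ) * k ≠ 1 := fun h1 => hx (by rw [← hfr k, h1]; simp)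
      rw [← hfr k]
      exact (Int.fract_eq_self.mpr ⟨h.1, lt_of_le_of_ne h.2 h1⟩).symm
    · exact absurd rfl hk
  by_cases h : ∃ k ∈ Finset.range m, sliceLength (x + ((ε : ℤ) : ℝ) * k) ≠ 0
  · obtain ⟨k, hk, hk0⟩ := h
    have h1 := hval k hk0
    rw [Finset.sum_eq_single_of_mem k hk, h1, sliceLength, if_pos
      ⟨Int.fract_nonneg x, (Int.fract_lt_one x).le⟩]
    intro l _ hl
    by_contra h2
    have h3 := (hval l h2).trans h1.symm
    have h4 : ((ε : ℤ) : ℝ) ≠ 0 := by exact_mod_cast ε.ne_zero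
    exact hl (by exact_mod_cast mul_left_cancel₀ h4 (add_left_cancel h3))
  · push Not at h
    rw [Finset.sum_eq_zero h]
    exact Int.fract_nonneg x

theorem intervalIntegrable_fract {f : ℝ → ℝ} (hf : Measurable f) (x y : ℝ) :
    IntervalIntegrable (fun t => Int.fract (f t)) volume x y := by
  refine (intervalIntegrable_const (c := (1 : ℝ))).mono_fun' hf.fract.aestronglyMeasurable ?_
  filter_upwards with t
  rw [Real.norm_eq_abs, abs_of_nonneg (Int.fract_nonneg _)]
  exact (Int.fract_lt_one _).le

theorem integral_fract_zero_one : ∫ t in (0 : ℝ)..1, Int.fract t = 1 / 2 := by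
  have : ∫ t in (0 : ℝ)..1, Int.fract t = ∫ t in (0 : ℝ)..1, t := by
    rw [intervalIntegral.integral_of_le zero_le_one, intervalIntegral.integral_of_le zero_le_one,
      integral_Ioc_eq_integral_Ioo, integral_Ioc_eq_integral_Ioo]
    exact setIntegral_congr_fun measurableSet_Ioo fun t ht =>
      Int.fract_eq_self.mpr ⟨ht.1.le, ht.2⟩
  rw [this]
  norm_num

/-- A change of variable turns this into an average over `k` full periods. -/
theorem integral_fract_linear (c : ℝ) {k : ℤ} (hk : k ≠ 0) :
    ∫ t in (0 : ℝ)..1, Int.fract (c + k * t) = 1 / 2 := by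
  have hk' : (k : ℝ) ≠ 0 := by exact_mod_cast hk
  have hp : Function.Periodic (Int.fract : ℝ → ℝ) 1 := Int.fract_periodic ℝ
  rw [intervalIntegral.integral_comp_add_mul _ hk']
  have := hp.intervalIntegral_add_zsmul_eq k c
    (fun x y => intervalIntegrable_fract measurable_id x y)
  simp only [zsmul_eq_mul, mul_one] at this
  rw [mul_zero, add_zero, mul_one, this, hp.intervalIntegral_add_eq c 0, zero_add,
    integral_fract_zero_one, smul_eq_mul]
  field_simp

theorem ae_fract_ne_zero (ε : ℤˣ) (a : ℝ) :
    ∀ᵐ t : ℝ, Int.fract (((ε : ℤ) : ℝ) * (t - a)) ≠ 0 := by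
  have hc : (range fun z : ℤ => a + ((ε : ℤ) : ℝ) * z).Countable := countable_range _
  filter_upwards [hc.ae_notMem volume] with t ht h0
  obtain ⟨z, hz⟩ := Int.fract_eq_zero_iff.mp h0
  refine ht ⟨z, ?_⟩
  have hε : ((ε : ℤ) : ℝ) * ((ε : ℤ) : ℝ) = 1 := by
    rcases Int.units_eq_one_or ε with h | h <;> simp [h]
  simp only [hz]
  linear_combination (t - a) * hε

theorem card_ge_of_slices {ι : Type*} [Fintype ι] (ε : ι → ℤˣ) (a : ι → ℝ) (n : ℕ) {d : ℝ}
    (hd : d ∈ Ioo (0 : ℝ) 1) (hpar : (2 : ℤ) ∣ (Fintype.card ι : ℤ) - n)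
    (h : ∀ x : ℝ, 0 ≤ x → x ≤ n + d → x ≤ ∑ i, sliceLength (((ε i : ℤ) : ℝ) * (x - a i))) :
    (n : ℝ) ^ 2 + 2 * (n + 1) * d ≤ Fintype.card ι := by
  set G : ℝ → ℝ := fun t => ∑ i, Int.fract (((ε i : ℤ) : ℝ) * (t - a i)) with hG
  set c : ℝ := - ∑ i, ((ε i : ℤ) : ℝ) * a i with hc
  set K : ℤ := ∑ i, (ε i : ℤ) - (n + 1) with hK
  -- Each sign is odd, so their sum has the parity of the number of triangles, that is of `n`; thus
  -- `K` is odd.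
  have hK0 : K ≠ 0 := by
    have h1 : (2 : ℤ) ∣ ∑ i, ((ε i : ℤ) - 1) := Finset.dvd_sum fun i _ => by
      rcases Int.units_eq_one_or (ε i) with h | h <;> simp [h]
    rw [Finset.sum_sub_distrib, Finset.sum_const, Finset.card_univ] at h1
    simp only [nsmul_eq_mul, mul_one] at h1
    omega
  have hint : ∀ x y, IntervalIntegrable G volume x y := fun x y => by
    have := IntervalIntegrable.sum (μ := volume) (a := x) (b := y) Finset.univ
      (f := fun i t => Int.fract (((ε i : ℤ) : ℝ) * (t - a i)))
      (fun i _ => intervalIntegrable_fract (by fun_prop) _ _)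
    rwa [show G = ∑ i, fun t => Int.fract (((ε i : ℤ) : ℝ) * (t - a i)) by funext t; simp [hG]]
  have hGint : ∫ t in (0 : ℝ)..1, G t = Fintype.card ι / 2 := by
    rw [hG, intervalIntegral.integral_finsetSum
      (fun i _ => intervalIntegrable_fract (by fun_prop) _ _)]
    have : ∀ i, ∫ t in (0 : ℝ)..1, Int.fract (((ε i : ℤ) : ℝ) * (t - a i)) = 1 / 2 := fun i => by
      rw [← integral_fract_linear (-(((ε i : ℤ) : ℝ) * a i)) (ε i).ne_zero]
      refine intervalIntegral.integral_congr fun t _ => ?_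
      ring_nf
    simp [this]
    ring
  have hGfr : ∀ t, ∃ z : ℤ, G t - (n + 1) * t = Int.fract (c + K * t) + z := fun t => by
    refine ⟨⌊c + K * t⌋ - ∑ i, ⌊((ε i : ℤ) : ℝ) * (t - a i)⌋, ?_⟩
    have : G t = ∑ i, (((ε i : ℤ) : ℝ) * (t - a i)) -
        ∑ i, (⌊((ε i : ℤ) : ℝ) * (t - a i)⌋ : ℝ) := by
      rw [← Finset.sum_sub_distrib]
      rfl
    rw [this, Int.fract, hc, hK]
    push_cast
    simp only [mul_sub, Finset.sum_sub_distrib, ← Finset.sum_mul]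
    ring
  have hae : ∀ᵐ t : ℝ, ∀ i, Int.fract (((ε i : ℤ) : ℝ) * (t - a i)) ≠ 0 :=
    ae_all_iff.mpr fun i => ae_fract_ne_zero _ _
  -- The bound on `t + m` keeps the deepest slice, at `t + m - 1`, inside `T`.
  have hlow : ∀ t : ℝ, (∀ i, Int.fract (((ε i : ℤ) : ℝ) * (t - a i)) ≠ 0) → 0 ≤ t → ∀ m : ℕ,
      t + m ≤ n + d + 1 → m * t + m * (m - 1) / 2 ≤ G t := fun t ht h0 m hm => by
    have hgauss : ∑ k ∈ Finset.range m, (t + k) = m * t + m * (m - 1) / 2 := by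
      clear hm
      induction m with
      | zero => simp
      | succ m ih => rw [Finset.sum_range_succ, ih]; push_cast; ring
    calc m * t + m * (m - 1) / 2 = ∑ k ∈ Finset.range m, (t + k) := hgauss.symm
      _ ≤ ∑ k ∈ Finset.range m, ∑ i, sliceLength (((ε i : ℤ) : ℝ) * (t + k - a i)) := by
          refine Finset.sum_le_sum fun k hk => h _ (by positivity) ?_
          have : (k : ℝ) + 1 ≤ m := by exact_mod_cast Finset.mem_range.mp hk
          linarith
      _ = ∑ i, ∑ k ∈ Finset.range m,
            sliceLength (((ε i : ℤ) : ℝ) * (t - a i) + ((ε i : ℤ) : ℝ) * k) := by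
          rw [Finset.sum_comm]
          refine Finset.sum_congr rfl fun i _ => Finset.sum_congr rfl fun k _ => ?_
          ring_nf
      _ ≤ G t := Finset.sum_le_sum fun i _ => sum_sliceLength_le_fract _ (ht i) _
  obtain ⟨C, hC⟩ : ∃ C : ℤ, (n : ℝ) * (n - 1) / 2 = C := by
    obtain ⟨C, hC⟩ := Int.even_mul_pred_self (n : ℤ)
    have hC' : (n : ℝ) * (n - 1) = C + C := by exact_mod_cast hC
    exact ⟨C, by linarith⟩
  -- the lower bound for `G` given by a lower bound for its integer part
  set B : ℤ → ℝ → ℝ := fun z t => (n + 1) * t + z + Int.fract (c + K * t) with hB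
  -- Here `n + 1` slices fit, so the integer part `z` plus a number below 1 is at least `C + n`;
  -- hence `z ≥ C + n`.
  have hG1 : ∀ᵐ t : ℝ, t ∈ Ioo 0 d → B (C + n) t ≤ G t := by
    filter_upwards [hae] with t ht htd
    obtain ⟨z, hz⟩ := hGfr t
    have h1 := hlow t ht htd.1.le (n + 1) (by push_cast; linarith [htd.2])
    have h2 := Int.fract_lt_one (c + K * t)
    push_cast at h1
    have h3 : ((C + n : ℤ) : ℝ) < ((z + 1 : ℤ) : ℝ) := by push_cast; linarith
    have h4 : ((C + n : ℤ) : ℝ) ≤ (z : ℝ) := by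
      exact_mod_cast Int.lt_add_one_iff.mp (Int.cast_lt.mp h3)
    simp only [hB]
    linarith
  -- Only `n` slices are used here: `z` plus a number below 1 is at least `C - t > C - 1`, so `z ≥ C
  -- - 1`.
  have hG2 : ∀ᵐ t : ℝ, t ∈ Ioo d 1 → B (C - 1) t ≤ G t := by
    filter_upwards [hae] with t ht htd
    obtain ⟨z, hz⟩ := hGfr t
    have h1 := hlow t ht (hd.1.trans htd.1).le n (by linarith [htd.2, hd.1])
    have h2 := Int.fract_lt_one (c + K * t)
    have h3 : ((C - 1 : ℤ) : ℝ) < ((z + 1 : ℤ) : ℝ) := by push_cast; linarith [htd.2]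
    have h4 : ((C - 1 : ℤ) : ℝ) ≤ (z : ℝ) := by
      exact_mod_cast Int.lt_add_one_iff.mp (Int.cast_lt.mp h3)
    simp only [hB]
    linarith
  have hr : ∀ x y, IntervalIntegrable (fun t : ℝ => Int.fract (c + K * t)) volume x y :=
    fun x y => intervalIntegrable_fract (by fun_prop) x y
  have hlin : ∀ (z : ℤ) x y,
      IntervalIntegrable (fun t : ℝ => ((n : ℝ) + 1) * t + z) volume x y :=
    fun z x y => (by fun_prop : Continuous _).intervalIntegrable x y
  have hBint : ∀ (z : ℤ) (x y : ℝ), ∫ t in x..y, B z t =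
      (n + 1) * (y ^ 2 - x ^ 2) / 2 + z * (y - x) + ∫ t in x..y, Int.fract (c + K * t) := by
    intro z x y
    rw [hB, intervalIntegral.integral_add (hlin z x y) (hr x y),
      intervalIntegral.integral_add ((by fun_prop : Continuous _).intervalIntegrable x y)
        intervalIntegrable_const, intervalIntegral.integral_const_mul, integral_id,
      intervalIntegral.integral_const, smul_eq_mul]
    ring
  have hmono : ∀ (z : ℤ) (x y : ℝ), x ≤ y → (∀ᵐ t : ℝ, t ∈ Ioo x y → B z t ≤ G t) →
      ∫ t in x..y, B z t ≤ ∫ t in x..y, G t := fun z x y hxy hz => by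
    refine intervalIntegral.integral_mono_ae_restrict hxy ((hlin z x y).add (hr x y)) (hint x y) ?_
    rw [← restrict_Ioo_eq_restrict_Icc]
    exact (ae_restrict_iff' measurableSet_Ioo).mpr hz
  have h1 := hmono _ _ _ hd.1.le hG1
  have h2 := hmono _ _ _ hd.2.le hG2
  rw [hBint] at h1 h2
  have h3 := intervalIntegral.integral_add_adjacent_intervals (hint 0 d) (hint d 1)
  have h4 := intervalIntegral.integral_add_adjacent_intervals (hr 0 d) (hr d 1)
  rw [integral_fract_linear c hK0] at h4
  rw [hGint] at h3
  push_cast at h1 h2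
  linarith

theorem IsUnitCovering.length_ge {n : ℕ} {d : ℝ} (hd : d ∈ Ioo (0 : ℝ) 1) {T : Tri}
    (hT : sideLength T = n + d) {F : List Tri} (hF : IsUnitCovering F T)
    (hpar : (2 : ℤ) ∣ (F.length : ℤ) - n) : (n : ℝ) ^ 2 + 2 * (n + 1) * d ≤ F.length := by
  have h := fun i : Fin F.length => (hF.1 F[i] (List.getElem_mem _)).exists_eq_unitCopy
  choose ε a b h using h
  have hcov : region T ⊆ ⋃ i, region (unitCopy T (ε i) (pt T (a i) (b i))) := by
    intro x hx
    obtain ⟨S, hS, hxS⟩ := mem_iUnion₂.mp (hF.2 hx)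
    obtain ⟨i, hi, rfl⟩ := List.mem_iff_getElem.mp hS
    exact mem_iUnion.mpr ⟨⟨i, hi⟩, by rw [← h]; exact hxS⟩
  have := card_ge_of_slices ε a n hd (by simpa using hpar)
    (fun x _ hx => le_sum_sliceLength T ε a b hcov (by rwa [hT]))
  simpa using this

/-! ### Upper bound: the sliding rows. -/

theorem pt_mem_upTri_iff (T : Tri) (a₀ b₀ a b : ℝ) :
    pt T a b ∈ region (upTri T a₀ b₀) ↔ b₀ ≤ b ∧ b - b₀ ≤ a - a₀ ∧ a - a₀ ≤ 1 := by
  rw [upTri, pt_mem_unitCopy_iff]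
  simp

theorem pt_mem_downTri_iff (T : Tri) (a₀ b₀ a b : ℝ) :
    pt T a b ∈ region (downTri T a₀ b₀) ↔ b ≤ b₀ ∧ b₀ - b ≤ a₀ - a ∧ a₀ - a ≤ 1 := by
  rw [downTri, pt_mem_unitCopy_iff]
  simp only [Units.val_neg, Units.val_one, Int.cast_neg, Int.cast_one]
  constructor <;> rintro ⟨h0, h1, h2⟩ <;> refine ⟨?_, ?_, ?_⟩ <;> linarith

theorem upTri_mem_row (T : Tri) {m i : ℕ} (D s : ℝ) (hi : i < m) :
    upTri T (D - 1) (i * (1 - s)) ∈ row T m D s :=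
  List.mem_append_left _ (List.mem_map.mpr ⟨i, by simpa using hi, rfl⟩)

theorem downTri_mem_row (T : Tri) {m i : ℕ} (D s : ℝ) (hi : i < m - 1) :
    downTri T (D - s) ((i + 1) * (1 - s)) ∈ row T m D s :=
  List.mem_append_right _ (List.mem_map.mpr ⟨i, by simpa using hi, rfl⟩)

/-- Acmes are spaced by `1 - s`. A point between two consecutive ones lies in the left up-triangle
or beyond its right leg, hence in the next down-triangle. The hypothesis `hD` puts the last acme on
or beyond the right leg of `T`. -/
theorem exists_mem_row (T : Tri) {m : ℕ} {D s a b : ℝ} (hm : 1 ≤ m) (hs1 : s < 1)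
    (hD : D - 1 ≤ (m - 1) * (1 - s)) (ha0 : D - 1 - s ≤ a) (ha1 : a ≤ D) (hb0 : 0 ≤ b)
    (hba : b ≤ a) : ∃ S ∈ row T m D s, pt T a b ∈ region S := by
  have hs : 0 < 1 - s := by linarith
  have hup : ∀ i : ℕ, i < m → i * (1 - s) ≤ b → b - i * (1 - s) ≤ a - (D - 1) →
      ∃ S ∈ row T m D s, pt T a b ∈ region S := fun i hi h1 h2 =>
    ⟨_, upTri_mem_row T D s hi, (pt_mem_upTri_iff ..).mpr ⟨h1, h2, by linarith⟩⟩
  by_cases hi : ⌊b / (1 - s)⌋₊ < m - 1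
  · have h1 := Nat.floor_le (div_nonneg hb0 hs.le)
    have h2 := Nat.lt_floor_add_one (b / (1 - s))
    set i := ⌊b / (1 - s)⌋₊
    rw [le_div_iff₀ hs] at h1
    rw [div_lt_iff₀ hs] at h2
    by_cases h3 : b - i * (1 - s) ≤ a - (D - 1)
    · exact hup i (by omega) h1 h3
    · exact ⟨_, downTri_mem_row T D s hi,
        (pt_mem_downTri_iff ..).mpr ⟨h2.le, by linarith, by linarith⟩⟩
  · have h1 : ((m - 1 : ℕ) : ℝ) ≤ b / (1 - s) :=
      (Nat.le_floor_iff (div_nonneg hb0 hs.le)).mp (not_lt.mp hi)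
    rw [le_div_iff₀ hs] at h1
    have h2 : ((m - 1 : ℕ) : ℝ) = m - 1 := by push_cast [hm]; rfl
    exact hup (m - 1) (by omega) h1 (by rw [h2]; linarith)

theorem depth_zero (j : ℕ) : depth j 0 = 0 := by simp [depth]

theorem depth_succ (j k : ℕ) : depth j (k + 1) = depth j k + 1 + slide j (k + 1) := by
  rw [depth, depth, Finset.sum_Icc_succ_top (by omega)]
  push_cast
  ring

theorem depth_of_lt {j k : ℕ} (h : k < j) : depth j k = k := by
  induction k with
  | zero => simp [depth_zero]
  | succ k ih =>
    rw [depth_succ, ih (by omega), slide, if_pos h]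
    push_cast
    ring

/-- The slides telescope, as `j / (k * (k + 1)) = j / k - j / (k + 1)`. The case `k = j - 1`, before
any slide, starts the sum. -/
theorem depth_of_le {j k : ℕ} (hj : 1 ≤ j) (h : j ≤ k + 1) :
    depth j k = k + 1 - j / (k + 1) := by
  induction k with
  | zero =>
    obtain rfl : j = 1 := by omega
    simp [depth_zero]
  | succ k ih =>
    rw [depth_succ]
    rcases h.lt_or_eq with h | rfl
    · rw [ih (by omega), slide, if_neg (by omega)]
      have : (k : ℝ) + 1 ≠ 0 := by positivity
      have : (k : ℝ) + 1 + 1 ≠ 0 := by positivity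
      push_cast
      field_simp
      ring
    · have : (k : ℝ) + 1 + 1 ≠ 0 := by positivity
      rw [depth_of_lt (by omega), slide, if_pos (by omega)]
      push_cast
      rw [div_self this]
      ring

theorem slide_lt_one (j : ℕ) {k : ℕ} (hk : 1 ≤ k) : slide j k < 1 := by
  rw [slide]
  split_ifs with h
  · exact one_pos
  · have h1 : (j : ℝ) ≤ k := by exact_mod_cast not_lt.mp h
    have h2 : (1 : ℝ) ≤ k := by exact_mod_cast hk
    rw [div_lt_one (by positivity)]
    nlinarith

/-- The last acme of each row lies exactly on the right leg of `T`; this dictates the slide values.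
-/
theorem depth_sub_one_eq {j k : ℕ} (hj : 1 ≤ j) (hk : 1 ≤ k) :
    depth j k - 1 = ((rowSize j k : ℝ) - 1) * (1 - slide j k) := by
  by_cases h : k < j
  · rw [depth_of_lt h, rowSize, slide, if_pos h, if_pos h]
    ring
  · rw [depth_of_le hj (by omega), rowSize, slide, if_neg h, if_neg h]
    have : (k : ℝ) ≠ 0 := by positivity
    push_cast
    field_simp
    ring

theorem region_subset_basicEven (T : Tri) {n j : ℕ} (hj : 1 ≤ j)
    (hn : 1 ≤ n) (hT : sideLength T ≤ depth j n) : region T ⊆ ⋃ S ∈ basicEven T n j, region S := by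
  intro x hx
  obtain ⟨a, b, hb0, hba, ha, rfl⟩ := (mem_region_self_iff T x).mp hx
  have ha' := ha.trans hT
  clear ha hT hx
  suffices h : ∃ S ∈ basicEven T n j, pt T a b ∈ region S by simpa using h
  induction n with
  | zero => omega
  | succ n ih =>
    rw [basicEven, List.range_succ, List.flatMap_append]
    by_cases h : 1 ≤ n ∧ a ≤ depth j n
    · obtain ⟨S, hS, hx⟩ := ih h.1 h.2
      exact ⟨S, List.mem_append_left _ hS, hx⟩
    -- The new row covers depths from `depth j n` on, so no gap is left below the previous row.
    · have h1 := depth_succ j n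
      have h2 : depth j n ≤ a := by
        rcases Nat.eq_zero_or_pos n with rfl | hn
        · rw [depth_zero]
          exact hb0.trans hba
        · exact (not_le.mp fun h2 => h ⟨hn, h2⟩).le
      obtain ⟨S, hS, hx⟩ := exists_mem_row T (m := rowSize j (n + 1)) (a := a) (b := b)
        (by rw [rowSize]; split_ifs <;> omega)
        (slide_lt_one j (by omega)) (depth_sub_one_eq hj (by omega)).le (by linarith) ha' hb0 hba
      exact ⟨S, List.mem_append_right _ (by simpa using hS), hx⟩

theorem length_row (T : Tri) (m : ℕ) (D s : ℝ) : (row T m D s).length = m + (m - 1) := by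
  simp [row]

theorem length_basicEven (T : Tri) (n : ℕ) {j : ℕ} (hj : 1 ≤ j) :
    (basicEven T n j).length = n ^ 2 + 2 * (n + 1 - j) := by
  induction n with
  | zero => simp [basicEven]; omega
  | succ n ih =>
    rw [basicEven, List.range_succ, List.flatMap_append, List.length_append]
    change (basicEven T n j).length + _ = _
    rw [ih, List.flatMap_singleton, length_row, rowSize]
    have : (n + 1) ^ 2 = n ^ 2 + 2 * n + 1 := by ring
    split_ifs <;> omega

theorem isHomotheticUnit_of_mem_row {T S : Tri} {m : ℕ} {D s : ℝ} (h : S ∈ row T m D s) :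
    IsHomotheticUnit S T := by
  rcases List.mem_append.mp h with h | h <;> obtain ⟨i, -, rfl⟩ := List.mem_map.mp h <;>
    exact isHomotheticUnit_unitCopy ..

theorem isUnitCovering_basicEven (T : Tri) {n j : ℕ} (hj : 1 ≤ j)
    (hn : 1 ≤ n) (hT : sideLength T ≤ depth j n) : IsUnitCovering (basicEven T n j) T := by
  refine ⟨fun S hS => ?_, region_subset_basicEven T hj hn hT⟩
  obtain ⟨i, -, hS⟩ := List.mem_flatMap.mp hS
  exact isHomotheticUnit_of_mem_row hS

/-- Coverings are lists, so padding with repeated copies of one triangle is allowed. -/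
theorem CoverableBy.mono {T : Tri} {M N : ℕ} (h : CoverableBy T M) (hMN : M ≤ N) :
    CoverableBy T N := by
  obtain ⟨F, hF, h1, h2⟩ := h
  refine ⟨F ++ List.replicate (N - M) (upTri T 0 0), by simp [hF, hMN], fun S hS => ?_,
    h2.trans fun x hx => ?_⟩
  · rcases List.mem_append.mp hS with hS | hS
    · exact h1 S hS
    · rw [List.eq_of_mem_replicate hS]
      exact isHomotheticUnit_unitCopy ..
  · obtain ⟨S, hS, hx⟩ := mem_iUnion₂.mp hx
    exact mem_iUnion₂.mpr ⟨S, List.mem_append_left _ hS, hx⟩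

theorem CoverableBy.le_div {n p : ℕ} {d : ℝ} (hd : d ∈ Ioo (0 : ℝ) 1) {T : Tri}
    (hT : sideLength T = n + d) (h : CoverableBy T (n ^ 2 + 2 * p)) :
    d ≤ (p : ℝ) / ((n : ℝ) + 1) := by
  obtain ⟨F, hF, hcov⟩ := h
  have h1 := hcov.length_ge hd hT (by
    obtain ⟨m, hm⟩ := Int.even_mul_pred_self (n : ℤ)
    refine ⟨m + p, ?_⟩
    rw [hF]
    push_cast
    linear_combination hm)
  rw [hF] at h1
  push_cast at h1
  rw [le_div_iff₀ (by positivity)]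
  linarith

end TriangleCovering

/-! ### Matching the two bounds. -/

open TriangleCovering in
theorem theorem5 (n p : ℕ) (hp : 1 ≤ p) (hpn : p ≤ n) (d : ℝ) (hd : d ∈ Set.Ioo (0 : ℝ) 1)
    (T : TriangleCovering.Tri) (hT : TriangleCovering.sideLength T = (n : ℝ) + d) :
    (TriangleCovering.CoverableBy T (n ^ 2 + 2 * p) ↔ d ≤ (p : ℝ) / ((n : ℝ) + 1)) ∧
    (d ≤ (p : ℝ) / ((n : ℝ) + 1) →
      TriangleCovering.IsUnitCovering (TriangleCovering.fullEven T n d) T ∧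
      ∃ q : ℕ, q ≤ p ∧ (TriangleCovering.fullEven T n d).length = n ^ 2 + 2 * q ∧
        IsLeast {q' : ℕ | 1 ≤ q' ∧ TriangleCovering.CoverableBy T (n ^ 2 + 2 * q')} q) := by
  have hn : (0 : ℝ) < n + 1 := by positivity
  have hpos : 0 ≤ (1 - d) * ((n : ℝ) + 1) := mul_nonneg (by linarith [hd.2]) hn.le
  set j := selectedRow n d with hj
  have hjn : j ≤ n := by
    refine Nat.lt_succ_iff.mp ((Nat.floor_lt hpos).mpr ?_)
    push_cast
    nlinarith [hd.1]
  -- The inequality says `n + 1 - q ≤ (1 - d) * (n + 1)`, and the floor preserves it. Combined with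
  -- the lower bound, this gives both `n + 1 - j ≤ p` and minimality.
  have hq : ∀ q : ℕ, q ≤ n → d ≤ (q : ℝ) / ((n : ℝ) + 1) → n + 1 - q ≤ j := fun q hqn h => by
    rw [le_div_iff₀ hn] at h
    refine Nat.le_floor ?_
    rw [Nat.cast_sub (by omega)]
    push_cast
    linarith
  have hmain : d ≤ (p : ℝ) / ((n : ℝ) + 1) →
      IsUnitCovering (fullEven T n d) T ∧ n + 1 - j ≤ p ∧
        (fullEven T n d).length = n ^ 2 + 2 * (n + 1 - j) := fun h => by
    have hpj := hq p hpn h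
    have hj1 : 1 ≤ j := by omega
    rw [fullEven, if_neg (by omega)]
    refine ⟨isUnitCovering_basicEven T hj1 (hp.trans hpn) ?_, by omega, length_basicEven T n hj1⟩
    have h1 : (j : ℝ) ≤ (1 - d) * ((n : ℝ) + 1) := Nat.floor_le hpos
    have h2 : (j : ℝ) / ((n : ℝ) + 1) ≤ 1 - d := (div_le_iff₀ hn).mpr h1
    rw [hT, depth_of_le hj1 (by omega)]
    linarith
  refine ⟨⟨fun h => h.le_div hd hT, fun h => ?_⟩, fun h => ?_⟩
  · obtain ⟨hcov, hle, hlen⟩ := hmain h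
    exact CoverableBy.mono ⟨_, hlen, hcov⟩ (by omega)
  · obtain ⟨hcov, hle, hlen⟩ := hmain h
    refine ⟨hcov, n + 1 - j, hle, hlen, ⟨by omega, _, hlen, hcov⟩, fun q' hq' => ?_⟩
    by_cases hqn : q' ≤ n
    · have := hq q' hqn (CoverableBy.le_div hd hT hq'.2)
      omega
    -- If `q' > n`, then `n + 1 - j ≤ p ≤ n < q'`.
    · omega
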